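/- Let $S$ be a commutative noetherian ring. Complexes of $S$-modules are graded homologically; for an object $X$ of the derived category $\mathsf D(S)$ let $\sup X$ and $\inf X$ be the supremum and infimum in $\mathbb Z\cup\{\pm\infty\}$ of $\{\ell\in\mathbb Z \mid \mathrm H_\ell(X)\neq 0\}$, and call $X$ homologically finite if the $S$-module $\bigoplus_{\ell}\mathrm H_\ell(X)$ is finitely generated. Let $\mathsf D^{\mathrm f}(S)$ be the full subcategory of homologically finite objects. An $S$-module $G$ is totally reflexive if $G\cong\operatorname{Coker}(L_1\to L_0)$ for an exact complex $L=(\cdots\to L_1\to L_0\to L_{-1}\to\cdots)$ of finitely generated free $S$-modules such that $\operatorname{Hom}_S(L,S)$ is exact. The G-dimension $\operatorname{G-dim}_S X$ is the infimum of the integers $d$ such that $X$ is isomorphic in $\mathsf D(S)$ to a complex $0\to G_d\to G_{d-1}\to\cdots\to G_i\to 0$ of totally reflexive modules. The projective dimension $\operatorname{pd}_S X$ is the infimum of the integers $d$ such that $X$ is isomorphic in $\mathsf D(S)$ to a semi-projective complex (a K-projective complex of projective modules) $Q$ with $Q_\ell=0$ for all $\ell>d$. Theorem. Let $N$ be a homologically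 finite $S$-complex with $\operatorname{G-dim}_S N<\infty$. For each integer $n\le\operatorname{G-dim}_S N$ there exists an exact triangle $$N\to P\to H\to\Sigma N$$ in $\mathsf D^{\mathrm f}(S)$ with the following properties: (a) $\operatorname{pd}_S P=\operatorname{G-dim}_S N$ and $\operatorname{G-dim}_S H\le n$. (b) There are inequalities $\inf P\ge n\ge\sup H$, and $$\max\{n,\sup N\}\ge\sup P\quad\text{and}\quad \inf H\ge\min\{n,\inf N+1\}.$$ Moreover, the following sequence of $S$-modules induced by the triangle is exact: $$0\to \mathrm H_n(N)\to \mathrm H_n(P)\to \mathrm H_n(H)\to \mathrm H_{n-1}(N)\to 0.$$ -/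

import Mathlib

open CategoryTheory CategoryTheory.Limits CategoryTheory.Pretriangulated

universe w u

/-- The integers with `-∞ = ⊥` and `∞ = ⊤` adjoined, a complete linear order. -/
abbrev ExtInt : Type := WithBot (WithTop ℤ)

/-- The inclusion of the integers in the extended integers. -/
def Int.toExt (n : ℤ) : ExtInt := ((n : WithTop ℤ) : WithBot (WithTop ℤ))

section Modules

variable {S : Type u} [CommRing S]

/-- A module `G` is totally reflexive if it is the cokernel of `L₁ ⟶ L₀` for an exact complex `L`
of finite free modules (indexed by all integers) such that the complex `Hom(L, S)` is exact. -/
def IsTotallyReflexive (G : ModuleCat.{u} S) : Prop :=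
  ∃ L : ChainComplex (ModuleCat.{u} S) ℤ,
    (∀ l : ℤ, Module.Free S (L.X l) ∧ Module.Finite S (L.X l)) ∧
    L.Acyclic ∧
    (∀ l : ℤ, Function.Exact (L.d (l + 1) l).hom.dualMap (L.d (l + 2) (l + 1)).hom.dualMap) ∧
    Nonempty (G ≅ cokernel (L.d 1 0))

end Modules

noncomputable section Derived

variable {S : Type u} [CommRing S] [HasDerivedCategory.{w} (ModuleCat.{u} S)]

/-- The homology module `H_l(X)`. Mathlib's derived category uses cohomological grading, and the
homological degree `l` is the cohomological degree `-l`. -/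
abbrev homologyMod (X : DerivedCategory (ModuleCat.{u} S)) (l : ℤ) : ModuleCat.{u} S :=
  (DerivedCategory.homologyFunctor (ModuleCat.{u} S) (-l)).obj X

/-- The map `H_l(f) : H_l(X) → H_l(Y)` induced by `f : X ⟶ Y`. -/
abbrev homologyModMap {X Y : DerivedCategory (ModuleCat.{u} S)} (f : X ⟶ Y) (l : ℤ) :
    homologyMod X l →ₗ[S] homologyMod Y l :=
  ((DerivedCategory.homologyFunctor (ModuleCat.{u} S) (-l)).map f).hom

/-- The connecting map `H_l(Z) → H_{l-1}(X)` of a triangle `X ⟶ Y ⟶ Z ⟶ ΣX`. -/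
abbrev homologyModConnecting (T : Triangle (DerivedCategory (ModuleCat.{u} S))) (l : ℤ) :
    homologyMod T.obj₃ l →ₗ[S] homologyMod T.obj₁ (l - 1) :=
  (DerivedCategory.HomologySequence.δ T (-l) (-(l - 1)) (by lia)).hom

/-- `sup X`, the supremum of the degrees in which the homology of `X` is nonzero. -/
def homologySup (X : DerivedCategory (ModuleCat.{u} S)) : ExtInt :=
  sSup (Int.toExt '' {l : ℤ | Nontrivial (homologyMod X l)})

/-- `inf X`, the infimum of the degrees in which the homology of `X` is nonzero. -/
def homologyInf (X : DerivedCategory (ModuleCat.{u} S)) : ExtInt :=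
  sInf (Int.toExt '' {l : ℤ | Nontrivial (homologyMod X l)})

/-- `X` is homologically finite if its total homology module is finitely generated, i.e. if all
homology modules are finitely generated and only finitely many of them are nonzero. -/
def IsHomologicallyFinite (X : DerivedCategory (ModuleCat.{u} S)) : Prop :=
  (∀ l : ℤ, Module.Finite S (homologyMod X l)) ∧
    {l : ℤ | Nontrivial (homologyMod X l)}.Finite

/-- The G-dimension: the infimum of the integers `d` such that `X` is isomorphic in the derived
category to a complex `0 → G_d → G_{d-1} → ⋯ → G_i → 0` of totally reflexive modules.
(In cohomological grading such a complex lives in degrees from `-d` to `-i`.) -/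
def gDim (X : DerivedCategory (ModuleCat.{u} S)) : ExtInt :=
  sInf (Int.toExt '' {d : ℤ | ∃ (i : ℤ) (K : CochainComplex (ModuleCat.{u} S) ℤ),
    K.IsStrictlyGE (-d) ∧ K.IsStrictlyLE (-i) ∧ (∀ l : ℤ, IsTotallyReflexive (K.X l)) ∧
      Nonempty (X ≅ DerivedCategory.Q.obj K)})

/-- The projective dimension: the infimum of the integers `d` such that `X` is isomorphic in the
derived category to a semi-projective (also called DG-projective) complex, that is, a K-projective
complex of projective modules, which vanishes in homological degrees above `d`. -/
def projDim (X : DerivedCategory (ModuleCat.{u} S)) : ExtInt :=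
  sInf (Int.toExt '' {d : ℤ | ∃ K : CochainComplex (ModuleCat.{u} S) ℤ,
    K.IsStrictlyGE (-d) ∧ K.IsKProjective ∧ (∀ l : ℤ, Module.Projective S (K.X l)) ∧
      Nonempty (X ≅ DerivedCategory.Q.obj K)})

end Derived

/-! The G-dimension of `N` is an integer `d`, since it is at least `n` and finite. Represent `N` by
a bounded complex of totally reflexive modules of minimal length at the top, change it so that its
terms in homological degrees at least `n` are free, and cut it there. In `Y`, the terms below `n`
form a subcomplex `W` and the terms from `n` on form the quotient `P`; rotating the triangle of `W →
Y → P` gives `N → P → ΣW`, with `H = ΣW`. The bounds on homology and the exact sequence follow from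
the long exact sequence, as `P` lives in degrees `≥ n` and `H` in degrees `≤ n`.

The terms are made free by `exists_complex_free_at`: a totally reflexive module embeds in a finite
free module with totally reflexive cokernel, and pushing out along the induced map of contractible
two-term complexes replaces one term by that free module and the neighbouring one by an extension of
totally reflexive modules. Closure under extensions is `isTotallyReflexive_of_extension`.

Clearly `pd P ≤ d`. If it were smaller, `exists_retraction_of_isKProjective` would split the top
differential of `P`, hence that of `Y`, and `exists_complex_of_retraction` would shorten `Y`,
against the minimality of `d`.

Complexes are indexed cohomologically: homological degree `l` is degree `-l`. -/

/-! ### Totally reflexive modules: syzygies, cosyzygies and extensions -/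

section TotallyReflexive

variable {S : Type u} [CommRing S]

/-- There is an exact sequence `0 → A → L → B → 0` with `L` finite free which stays exact under
`Hom(-, S)`. -/
def HasDualExactFreeExtension (A B : ModuleCat.{u} S) : Prop :=
  ∃ (L : ModuleCat.{u} S) (i : A →ₗ[S] L) (p : L →ₗ[S] B),
    Module.Free S L ∧ Module.Finite S L ∧ Function.Injective i ∧ Function.Exact i p ∧
      Function.Surjective p ∧ ∀ φ : A →ₗ[S] S, ∃ ψ : L →ₗ[S] S, ψ ∘ₗ i = φ

theorem HasDualExactFreeExtension.congr {A B A' B' : ModuleCat.{u} S}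
    (h : HasDualExactFreeExtension A B) (e : A' ≃ₗ[S] A) (e' : B ≃ₗ[S] B') :
    HasDualExactFreeExtension A' B' := by
  obtain ⟨L, i, p, h1, h2, hi, hex, hp, hd⟩ := h
  refine ⟨L, i ∘ₗ e, e' ∘ₗ p, h1, h2, hi.comp e.injective, ?_, e'.surjective.comp hp, fun φ => ?_⟩
  · intro y
    have : e' (p y) = 0 ↔ p y = 0 := e'.map_eq_zero_iff
    simp only [LinearMap.comp_apply, LinearEquiv.coe_coe, this, hex y]
    exact ⟨fun ⟨x, hx⟩ => ⟨e.symm x, by simpa using hx⟩, fun ⟨x, hx⟩ => ⟨e x, hx⟩⟩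
  · obtain ⟨ψ, hψ⟩ := hd (φ ∘ₗ e.symm)
    refine ⟨ψ, ?_⟩
    rw [← LinearMap.comp_assoc, hψ]
    ext x
    simp

theorem LinearMap.exists_comp_eq_of_surjective {M N P : Type*} [AddCommGroup M] [AddCommGroup N]
    [AddCommGroup P] [Module S M] [Module S N] [Module S P] (p : M →ₗ[S] N)
    (hp : Function.Surjective p) (φ : M →ₗ[S] P) (h : LinearMap.ker p ≤ LinearMap.ker φ) :
    ∃ χ : N →ₗ[S] P, χ ∘ₗ p = φ := by
  refine ⟨(LinearMap.ker p).liftQ φ h ∘ₗ (p.quotKerEquivOfSurjective hp).symm, ?_⟩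
  ext x
  have : (p.quotKerEquivOfSurjective hp).symm (p x) = (LinearMap.ker p).mkQ x := by
    rw [LinearEquiv.symm_apply_eq]; rfl
  simp [this]

/-- Iterated predecessors fill the positive indices, iterated successors the negative ones. -/
theorem exists_int_indexed_chain {α : Type*} (r : α → α → Prop) (hl : ∀ b, ∃ a, r a b)
    (hr : ∀ a, ∃ b, r a b) (x : α) : ∃ z : ℤ → α, z 0 = x ∧ ∀ l, r (z (l + 1)) (z l) := by
  choose f hf using hl
  choose g hg using hr
  refine ⟨fun l => match l with
    | Int.ofNat k => f^[k] x
    | Int.negSucc k => g^[k + 1] x, rfl, fun l => ?_⟩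
  match l with
  | Int.ofNat k =>
    change r (f^[k + 1] x) (f^[k] x)
    rw [Function.iterate_succ_apply']
    exact hf _
  | Int.negSucc 0 => exact hg x
  | Int.negSucc (k + 1) =>
    have : Int.negSucc (k + 1) + 1 = Int.negSucc k := rfl
    rw [this]
    change r (g^[k + 1] x) (g^[k + 1 + 1] x)
    rw [Function.iterate_succ_apply' g (k + 1)]
    exact hg _

theorem acyclic_iff_exact (L : ChainComplex (ModuleCat.{u} S) ℤ) :
    L.Acyclic ↔ ∀ l : ℤ, Function.Exact (L.d (l + 1 + 1) (l + 1)).hom (L.d (l + 1) l).hom := by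
  have key (l : ℤ) : L.ExactAt (l + 1) ↔
      Function.Exact (L.d (l + 1 + 1) (l + 1)).hom (L.d (l + 1) l).hom := by
    rw [L.exactAt_iff' (l + 1 + 1) (l + 1) l (by simp) (by simp),
      ShortComplex.ShortExact.moduleCat_exact_iff_function_exact]
    rfl
  refine ⟨fun h l => (key l).1 (h _), fun h l => ?_⟩
  obtain ⟨m, rfl⟩ : ∃ m, l = m + 1 := ⟨l - 1, by lia⟩
  exact (key m).2 (h m)

theorem IsTotallyReflexive.of_iso {G G' : ModuleCat.{u} S} (h : IsTotallyReflexive G)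
    (e : G' ≅ G) : IsTotallyReflexive G' := by
  obtain ⟨L, h1, h2, h3, ⟨e'⟩⟩ := h
  exact ⟨L, h1, h2, h3, ⟨e ≪≫ e'⟩⟩

/-- A class of modules that admits dual exact free extensions within the class on both sides
consists of totally reflexive modules. -/
theorem isTotallyReflexive_of_class (C : ModuleCat.{u} S → Prop)
    (hl : ∀ B, C B → ∃ A, C A ∧ HasDualExactFreeExtension A B)
    (hr : ∀ A, C A → ∃ B, C B ∧ HasDualExactFreeExtension A B)
    {G : ModuleCat.{u} S} (hG : C G) : IsTotallyReflexive G := by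
  obtain ⟨Z, hZ0, hZ⟩ := exists_int_indexed_chain
    (α := {G : ModuleCat.{u} S // C G}) (fun A B => HasDualExactFreeExtension A.1 B.1)
    (fun b => by obtain ⟨A, hA, h⟩ := hl b.1 b.2; exact ⟨⟨A, hA⟩, h⟩)
    (fun b => by obtain ⟨A, hA, h⟩ := hr b.1 b.2; exact ⟨⟨A, hA⟩, h⟩) ⟨G, hG⟩
  choose L i p hfree hfin hi hex hp hd using hZ
  -- The short exact sequences are spliced: `L (l + 1) → Z (l + 1) → L l`.
  let d (l : ℤ) : L (l + 1) →ₗ[S] L l := i l ∘ₗ p (l + 1)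
  have hdd (l : ℤ) : Function.Exact (d (l + 1)) (d l) := by
    intro y
    simp only [d, LinearMap.comp_apply, map_eq_zero_iff _ (hi l)]
    rw [hex (l + 1) y]
    exact ⟨fun ⟨z, hz⟩ => by
      obtain ⟨w, rfl⟩ := hp _ z
      exact ⟨w, hz⟩, fun ⟨w, hw⟩ => ⟨_, hw⟩⟩
  have hdual (l : ℤ) : Function.Exact (d l).dualMap (d (l + 1)).dualMap := by
    intro φ
    constructor
    · intro h
      have hz : ∀ x, i (l + 1) x ∈ LinearMap.ker φ := fun x => by
        obtain ⟨y, rfl⟩ := hp _ x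
        exact LinearMap.congr_fun h y
      have hk : LinearMap.ker (p (l + 1)) ≤ LinearMap.ker φ := fun y hy => by
        obtain ⟨x, rfl⟩ := (hex (l + 1) y).1 hy
        exact hz x
      obtain ⟨χ, hχ⟩ := (LinearMap.exists_comp_eq_of_surjective (p (l + 1)) (hp _) φ hk)
      obtain ⟨ψ, hψ⟩ := hd l χ
      refine ⟨ψ, ?_⟩
      rw [← hχ, ← hψ]
      rfl
    · rintro ⟨ψ, rfl⟩
      ext y
      exact (congrArg ψ ((hdd l _).2 ⟨y, rfl⟩)).trans (map_zero ψ)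
  let K : ChainComplex (ModuleCat.{u} S) ℤ := ChainComplex.of L (fun l => ModuleCat.ofHom (d l))
    (fun l => by ext y; exact (hdd l _).2 ⟨y, rfl⟩)
  have hK (l : ℤ) : K.d (l + 1) l = ModuleCat.ofHom (d l) := by
    dsimp only [K, ChainComplex.of]
    exact ChainComplex.of_d _ _ _
  refine ⟨K, fun l => ⟨hfree l, hfin l⟩, (acyclic_iff_exact K).2 fun l => ?_, fun l => ?_, ?_⟩
  · rw [hK, hK]
    exact hdd l
  · rw [show l + 2 = l + 1 + 1 by ring, hK, hK]
    exact hdual l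
  · have hcok : Function.Exact (d 0) (p 0) := by
      intro y
      rw [hex 0 y]
      exact ⟨fun ⟨z, hz⟩ => by
        obtain ⟨w, rfl⟩ := hp _ z
        exact ⟨w, hz⟩, fun ⟨w, hw⟩ => ⟨_, hw⟩⟩
    let e : (K.X 0 ⧸ LinearMap.range (K.d 1 0).hom) ≃ₗ[S] Z 0 :=
      (Submodule.quotEquivOfEq _ _ (by
        have : K.d 1 0 = ModuleCat.ofHom (d 0) := hK 0
        rw [this]
        exact (LinearMap.exact_iff.1 hcok).symm)) ≪≫ₗ (p 0).quotKerEquivOfSurjective (hp 0)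
    have hG' : G = (Z 0).1 := by rw [hZ0]
    exact ⟨eqToIso hG' ≪≫ e.symm.toModuleIso ≪≫
      (ModuleCat.cokernelIsoRangeQuotient (K.d 1 0)).symm⟩

/-- By exactness the left cokernel is the image of the differential into `L.X l`. A functional on it
is a cocycle of `Hom(L, S)`, hence a coboundary, and this provides the extension to `L.X l`. -/
theorem exists_hasDualExactFreeExtension_of_complex (L : ChainComplex (ModuleCat.{u} S) ℤ)
    (h1 : ∀ l : ℤ, Module.Free S (L.X l) ∧ Module.Finite S (L.X l)) (h2 : L.Acyclic)
    (h3 : ∀ l : ℤ, Function.Exact (L.d (l + 1) l).hom.dualMap (L.d (l + 2) (l + 1)).hom.dualMap)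
    (l : ℤ) : HasDualExactFreeExtension
      (cokernel (L.d (l + 1 + 1) (l + 1))) (cokernel (L.d (l + 1) l)) := by
  have hex := (acyclic_iff_exact L).1 h2 l
  have hd := h3 l
  rw [show l + 2 = l + 1 + 1 by ring] at hd
  have hle : LinearMap.range (L.d (l + 1 + 1) (l + 1)).hom ≤ LinearMap.ker (L.d (l + 1) l).hom :=
    (LinearMap.exact_iff.1 hex).ge
  have : HasDualExactFreeExtension
      (ModuleCat.of S (L.X (l + 1) ⧸ LinearMap.range (L.d (l + 1 + 1) (l + 1)).hom))
      (ModuleCat.of S (L.X l ⧸ LinearMap.range (L.d (l + 1) l).hom)) := by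
    refine ⟨L.X l, Submodule.liftQ _ _ hle, Submodule.mkQ _, (h1 l).1, (h1 l).2, ?_, ?_,
      Submodule.mkQ_surjective _, fun φ => ?_⟩
    · rw [← LinearMap.ker_eq_bot, Submodule.ker_liftQ_eq_bot']
      exact (LinearMap.exact_iff.1 hex).symm
    · rw [LinearMap.exact_iff, Submodule.ker_mkQ, Submodule.range_liftQ]
    · obtain ⟨ψ, hψ⟩ := (hd (φ ∘ₗ Submodule.mkQ _)).1 (by
        ext x
        have : (Submodule.mkQ (LinearMap.range (L.d (l + 1 + 1) (l + 1)).hom))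
            ((L.d (l + 1 + 1) (l + 1)).hom x) = 0 := by
          rw [Submodule.mkQ_apply, Submodule.Quotient.mk_eq_zero]
          exact ⟨x, rfl⟩
        exact (congrArg φ this).trans (map_zero φ))
      refine ⟨ψ, ?_⟩
      apply Submodule.linearMap_qext
      exact hψ
  exact this.congr (ModuleCat.cokernelIsoRangeQuotient _).toLinearEquiv
    (ModuleCat.cokernelIsoRangeQuotient _).symm.toLinearEquiv

/-- The complex `L` reindexed so that degree `k` becomes degree `0`. -/
def reindexComplex (L : ChainComplex (ModuleCat.{u} S) ℤ) (k : ℤ) :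
    ChainComplex (ModuleCat.{u} S) ℤ where
  X l := L.X (l + k)
  d i j := L.d (i + k) (j + k)
  shape i j h := L.shape _ _ (by simp at h ⊢; lia)

/-- The definition only mentions degree `0`; reindexing makes every syzygy and cosyzygy totally
reflexive. -/
theorem isTotallyReflexive_cokernel (L : ChainComplex (ModuleCat.{u} S) ℤ)
    (h1 : ∀ l : ℤ, Module.Free S (L.X l) ∧ Module.Finite S (L.X l)) (h2 : L.Acyclic)
    (h3 : ∀ l : ℤ, Function.Exact (L.d (l + 1) l).hom.dualMap (L.d (l + 2) (l + 1)).hom.dualMap)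
    (k : ℤ) : IsTotallyReflexive (cokernel (L.d (k + 1) k)) := by
  refine ⟨reindexComplex L k, fun l => h1 _, (acyclic_iff_exact _).2 fun l => ?_, fun l => ?_, ?_⟩
  · have : Function.Exact (L.d (l + 1 + 1 + k) (l + 1 + k)).hom (L.d (l + 1 + k) (l + k)).hom := by
      rw [show l + 1 + 1 + k = l + k + 1 + 1 by ring, show l + 1 + k = l + k + 1 by ring]
      exact (acyclic_iff_exact L).1 h2 (l + k)
    exact this
  · have : Function.Exact (L.d (l + 1 + k) (l + k)).hom.dualMap
        (L.d (l + 2 + k) (l + 1 + k)).hom.dualMap := by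
      rw [show l + 2 + k = l + k + 2 by ring, show l + 1 + k = l + k + 1 by ring]
      exact h3 (l + k)
    exact this
  · have : Nonempty (cokernel (L.d (k + 1) k) ≅ cokernel (L.d (1 + k) (0 + k))) := by
      rw [show (1 : ℤ) + k = k + 1 by ring, zero_add]
      exact ⟨Iso.refl _⟩
    exact this

theorem IsTotallyReflexive.exists_left {G : ModuleCat.{u} S} (h : IsTotallyReflexive G) :
    ∃ A, IsTotallyReflexive A ∧ HasDualExactFreeExtension A G := by
  obtain ⟨L, h1, h2, h3, ⟨e⟩⟩ := h
  have := exists_hasDualExactFreeExtension_of_complex L h1 h2 h3 0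
  rw [zero_add] at this
  exact ⟨_, isTotallyReflexive_cokernel L h1 h2 h3 1,
    this.congr (LinearEquiv.refl _ _) e.symm.toLinearEquiv⟩

theorem IsTotallyReflexive.exists_right {G : ModuleCat.{u} S} (h : IsTotallyReflexive G) :
    ∃ B, IsTotallyReflexive B ∧ HasDualExactFreeExtension G B := by
  obtain ⟨L, h1, h2, h3, ⟨e⟩⟩ := h
  have := exists_hasDualExactFreeExtension_of_complex L h1 h2 h3 (-1)
  rw [neg_add_cancel, zero_add] at this
  exact ⟨_, by simpa using isTotallyReflexive_cokernel L h1 h2 h3 (-1),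
    this.congr e.toLinearEquiv (LinearEquiv.refl _ _)⟩

theorem IsTotallyReflexive.finite {G : ModuleCat.{u} S} (h : IsTotallyReflexive G) :
    Module.Finite S G := by
  obtain ⟨A, -, L, i, p, -, _, -, -, hp, -⟩ := h.exists_left
  exact Module.Finite.of_surjective p hp

theorem isTotallyReflexive_of_projective {G : ModuleCat.{u} S} [Module.Projective S G]
    [Module.Finite S G] : IsTotallyReflexive G := by
  -- A complement `K` of `G` in a finite free module gives split sequences in both directions, so
  -- finite projectives form a class closed on both sides.
  have split (G : ModuleCat.{u} S) (_ : Module.Projective S G) (_ : Module.Finite S G) :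
      ∃ K : ModuleCat.{u} S, (Module.Projective S K ∧ Module.Finite S K) ∧
        HasDualExactFreeExtension K G ∧ HasDualExactFreeExtension G K := by
    obtain ⟨n, f, hf⟩ := Module.Finite.exists_fin' S G
    obtain ⟨s, hs⟩ := Module.projective_lifting_property f LinearMap.id hf
    have hs' (x : G) : f (s x) = x := LinearMap.congr_fun hs x
    let r : (Fin n → S) →ₗ[S] LinearMap.ker f :=
      (LinearMap.id - s ∘ₗ f).codRestrict _ fun x => by simp [hs']
    have hr (x : LinearMap.ker f) : r x = x := Subtype.ext (by simp [r])
    have hrs : Function.Surjective r := fun x => ⟨x, hr x⟩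
    refine ⟨ModuleCat.of S (LinearMap.ker f), ⟨?_, Module.Finite.of_surjective r hrs⟩,
      ⟨ModuleCat.of S (Fin n → S), (LinearMap.ker f).subtype, f, inferInstance, inferInstance,
        Subtype.val_injective, LinearMap.exact_subtype_ker_map f, hf, fun φ => ⟨φ ∘ₗ r, ?_⟩⟩,
      ⟨ModuleCat.of S (Fin n → S), s, r, inferInstance, inferInstance,
        Function.LeftInverse.injective hs', ?_, hrs, fun φ => ⟨φ ∘ₗ f, ?_⟩⟩⟩
    · exact Module.Projective.of_split (LinearMap.ker f).subtype r (LinearMap.ext hr)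
    · ext x
      simp [hr]
    · intro y
      constructor
      · intro h
        refine ⟨f y, ?_⟩
        have := congrArg Subtype.val h
        simp only [r, LinearMap.codRestrict_apply, LinearMap.sub_apply, LinearMap.id_apply,
          LinearMap.comp_apply, ZeroMemClass.coe_zero] at this
        exact (sub_eq_zero.1 this).symm
      · rintro ⟨x, rfl⟩
        exact Subtype.ext (by simp [r, hs'])
    · ext x
      simp [hs']
  refine isTotallyReflexive_of_class (fun G => Module.Projective S G ∧ Module.Finite S G)
    (fun B hB => ?_) (fun B hB => ?_) ⟨‹_›, ‹_›⟩
  · obtain ⟨K, hK, h1, h2⟩ := split B hB.1 hB.2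
    exact ⟨K, hK, h1⟩
  · obtain ⟨K, hK, h1, h2⟩ := split B hB.1 hB.2
    exact ⟨K, hK, h2⟩

/-- This is the vanishing of `Ext¹(C, S)`. With `0 → K → L → C → 0` dual exact, `B` is a quotient of
`A × L`; extending to `L` the functional that `φ` induces on `K` makes the pair of functionals
descend to `B`. -/
theorem IsTotallyReflexive.exists_extend {A B C : ModuleCat.{u} S} (hC : IsTotallyReflexive C)
    (i : A →ₗ[S] B) (p : B →ₗ[S] C) (hi : Function.Injective i) (hex : Function.Exact i p)
    (hp : Function.Surjective p) (φ : A →ₗ[S] S) : ∃ ψ : B →ₗ[S] S, ψ ∘ₗ i = φ := by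
  obtain ⟨K, -, L, j, q, _, -, hj, hjq, hq, hd⟩ := hC.exists_left
  obtain ⟨s, hs⟩ := Module.projective_lifting_property p q hp
  have hs' (x : L) : p (s x) = q x := LinearMap.congr_fun hs x
  have hpi (a : A) : p (i a) = 0 := (hex _).2 ⟨a, rfl⟩
  have hqj (a : K) : q (j a) = 0 := (hjq _).2 ⟨a, rfl⟩
  let t : K →ₗ[S] LinearMap.range i := (s ∘ₗ j).codRestrict _ fun x => by
    rw [LinearMap.mem_range]
    exact (hex _).1 (by simp [hs', hqj])
  let e := LinearEquiv.ofInjective i hi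
  have ht (x : K) : i (e.symm (t x)) = s (j x) :=
    congrArg Subtype.val (e.apply_symm_apply (t x))
  obtain ⟨χ, hχ⟩ := hd (φ ∘ₗ e.symm ∘ₗ t)
  have hχ' (x : K) : χ (j x) = φ (e.symm (t x)) := LinearMap.congr_fun hχ x
  have hsurj : Function.Surjective (i.coprod s) := fun b => by
    obtain ⟨x, hx⟩ := hq (p b)
    obtain ⟨a, ha⟩ := (hex (b - s x)).1 (by simp [hs', hx])
    exact ⟨(a, x), by simp [ha]⟩
  obtain ⟨ψ, hψ⟩ := LinearMap.exists_comp_eq_of_surjective _ hsurj (φ.coprod χ) (by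
    rintro ⟨a, x⟩ h
    simp only [LinearMap.mem_ker, LinearMap.coprod_apply] at h ⊢
    obtain ⟨y, rfl⟩ := (hjq x).1 (by simpa [hpi, hs'] using congrArg p h)
    rw [hχ', ← map_add]
    have : a + e.symm (t y) = 0 := hi (by rw [map_add, ht, h, map_zero])
    rw [this, map_zero])
  refine ⟨ψ, ?_⟩
  ext a
  simpa using LinearMap.congr_fun hψ (a, 0)

/-- An extension of totally reflexive modules is totally reflexive. -/
theorem isTotallyReflexive_of_extension {A B C : ModuleCat.{u} S} (hA : IsTotallyReflexive A)
    (hC : IsTotallyReflexive C) (i : A →ₗ[S] B) (p : B →ₗ[S] C) (hi : Function.Injective i)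
    (hex : Function.Exact i p) (hp : Function.Surjective p) : IsTotallyReflexive B := by
  refine isTotallyReflexive_of_class (fun B => ∃ (A C : ModuleCat.{u} S) (i : A →ₗ[S] B)
    (p : B →ₗ[S] C), IsTotallyReflexive A ∧ IsTotallyReflexive C ∧ Function.Injective i ∧
      Function.Exact i p ∧ Function.Surjective p) ?_ ?_ ⟨A, C, i, p, hA, hC, hi, hex, hp⟩
  · rintro B ⟨A, C, i, p, hA, hC, hi, hex, hp⟩
    have hpi (a : A) : p (i a) = 0 := (hex _).2 ⟨a, rfl⟩
    obtain ⟨A', hA', L, j, q, _, _, hj, hjq, hq, hd⟩ := hA.exists_left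
    obtain ⟨C', hC', M, k, r, _, _, hk, hkr, hr, hd'⟩ := hC.exists_left
    have hqj (a : A') : q (j a) = 0 := (hjq _).2 ⟨a, rfl⟩
    have hrk (a : C') : r (k a) = 0 := (hkr _).2 ⟨a, rfl⟩
    obtain ⟨s, hs⟩ := Module.projective_lifting_property p r hp
    have hs' (x : M) : p (s x) = r x := LinearMap.congr_fun hs x
    -- Horseshoe construction: `ker π` is an extension of `C'` by `A'`, so it lies in the class
    -- again.
    let π : (L × M) →ₗ[S] B := (i ∘ₗ q).coprod s
    have hπ (x : L × M) : π x = i (q x.1) + s x.2 := rfl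
    let a : A' →ₗ[S] LinearMap.ker π := (LinearMap.inl S L M ∘ₗ j).codRestrict _ fun x => by
      simp [hπ, hqj]
    let e := LinearEquiv.ofInjective k hk
    let c₀ : LinearMap.ker π →ₗ[S] LinearMap.range k :=
      (LinearMap.snd S L M ∘ₗ (LinearMap.ker π).subtype).codRestrict _ fun x => by
        rw [LinearMap.mem_range]
        refine (hkr _).1 ?_
        have := congrArg p (x.2 : π x = 0)
        simpa [hπ, hpi, hs'] using this
    let c : LinearMap.ker π →ₗ[S] C' := e.symm ∘ₗ c₀
    have hc (x : LinearMap.ker π) : k (c x) = x.1.2 :=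
      congrArg Subtype.val (e.apply_symm_apply (c₀ x))
    have hai : Function.Injective a := fun x y h => hj (congrArg (fun z => z.1.1) h)
    have hac : Function.Exact a c := by
      intro x
      constructor
      · intro h
        have h2 : x.1.2 = 0 := by rw [← hc, h, map_zero]
        have h1 : q x.1.1 = 0 := hi (by
          have : π x.1 = 0 := x.2
          simpa [hπ, h2] using this)
        obtain ⟨y, hy⟩ := (hjq _).1 h1
        exact ⟨y, Subtype.ext (Prod.ext hy h2.symm)⟩
      · rintro ⟨y, rfl⟩
        exact hk (by rw [hc, map_zero]; rfl)
    have hcs : Function.Surjective c := fun y => by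
      obtain ⟨z, hz⟩ := (hex (s (k y))).1 (by rw [hs', hrk])
      obtain ⟨w, rfl⟩ := hq z
      refine ⟨⟨(-w, k y), by simp [hπ, hz]⟩, hk (by rw [hc])⟩
    refine ⟨ModuleCat.of S (LinearMap.ker π), ⟨A', C', a, c, hA', hC', hai, hac, hcs⟩,
      ModuleCat.of S (L × M), (LinearMap.ker π).subtype, π, inferInstanceAs (Module.Free S (L × M)),
      inferInstanceAs (Module.Finite S (L × M)), Subtype.val_injective,
      LinearMap.exact_subtype_ker_map π, fun b => ?_, fun φ => ?_⟩
    · obtain ⟨x, hx⟩ := hr (p b)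
      obtain ⟨y, hy⟩ := (hex (b - s x)).1 (by simp [hs', hx])
      obtain ⟨z, rfl⟩ := hq y
      exact ⟨(z, x), by simp [hπ, hy]⟩
    -- Extend the restriction of `φ` to `A'` over `L`; the remaining difference factors through `C'`
    -- and extends over `M`.
    · obtain ⟨ψ, hψ⟩ := hd (φ ∘ₗ a)
      have hψ' (x : A') : ψ (j x) = φ (a x) := LinearMap.congr_fun hψ x
      let φ' : LinearMap.ker π →ₗ[S] S :=
        φ - ψ ∘ₗ LinearMap.fst S L M ∘ₗ (LinearMap.ker π).subtype
      obtain ⟨χ, hχ⟩ := LinearMap.exists_comp_eq_of_surjective c hcs φ' (by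
        intro x hx
        obtain ⟨y, rfl⟩ := (hac x).1 hx
        rw [LinearMap.mem_ker]
        change φ (a y) - ψ (j y) = 0
        rw [hψ', sub_self])
      obtain ⟨ω, hω⟩ := hd' χ
      refine ⟨ψ.coprod ω, ?_⟩
      ext x
      have h1 := LinearMap.congr_fun hχ x
      have h2 := LinearMap.congr_fun hω (c x)
      change χ (c x) = φ x - ψ x.1.1 at h1
      change ω (k (c x)) = χ (c x) at h2
      rw [hc, h1] at h2
      change ψ x.1.1 + ω x.1.2 = φ x
      rw [h2]
      abel
  · rintro B ⟨A, C, i, p, hA, hC, hi, hex, hp⟩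
    have hpi (a : A) : p (i a) = 0 := (hex _).2 ⟨a, rfl⟩
    obtain ⟨A', hA', L, j, q, _, _, hj, hjq, hq, hd⟩ := hA.exists_right
    obtain ⟨C', hC', M, k, r, _, _, hk, hkr, hr, hd'⟩ := hC.exists_right
    have hqj (a : A) : q (j a) = 0 := (hjq _).2 ⟨a, rfl⟩
    have hrk (a : C) : r (k a) = 0 := (hkr _).2 ⟨a, rfl⟩
    -- The dual horseshoe needs `A → L` to extend to `B`; this is done coordinatewise, using that
    -- functionals extend along `i`.
    obtain ⟨f, hf⟩ : ∃ f : B →ₗ[S] L, f ∘ₗ i = j := by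
      let b := Module.Free.chooseBasis S L
      choose g hg using fun n => hC.exists_extend i p hi hex hp (b.coord n ∘ₗ j)
      refine ⟨(b.equivFun.symm : _ →ₗ[S] L) ∘ₗ LinearMap.pi g, ?_⟩
      ext x
      apply b.equivFun.injective
      funext n
      change b.equivFun (b.equivFun.symm (LinearMap.pi g (i x))) n = _
      rw [LinearEquiv.apply_symm_apply]
      exact LinearMap.congr_fun (hg n) x
    have hf' (x : A) : f (i x) = j x := LinearMap.congr_fun hf x
    let ι : B →ₗ[S] L × M := f.prod (k ∘ₗ p)
    have hι (x : B) : ι x = (f x, k (p x)) := rfl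
    let Q := (L × M) ⧸ LinearMap.range ι
    have hmk (x : L × M) : (LinearMap.range ι).mkQ x = 0 ↔ ∃ b, ι b = x := by
      rw [Submodule.mkQ_apply, Submodule.Quotient.mk_eq_zero, LinearMap.mem_range]
    obtain ⟨a, ha⟩ := LinearMap.exists_comp_eq_of_surjective q hq
      ((LinearMap.range ι).mkQ ∘ₗ LinearMap.inl S L M) (by
        intro x hx
        obtain ⟨y, rfl⟩ := (hjq x).1 hx
        refine (hmk _).2 ⟨i y, ?_⟩
        rw [hι, hf', hpi, map_zero]
        rfl)
    have ha' (x : L) : a (q x) = (LinearMap.range ι).mkQ (x, 0) := LinearMap.congr_fun ha x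
    obtain ⟨c, hc⟩ := LinearMap.exists_comp_eq_of_surjective (LinearMap.range ι).mkQ
      (Submodule.mkQ_surjective _) (r ∘ₗ LinearMap.snd S L M) (by
        intro x hx
        obtain ⟨b, rfl⟩ := (hmk x).1 hx
        exact hrk _)
    have hc' (x : L × M) : c ((LinearMap.range ι).mkQ x) = r x.2 := LinearMap.congr_fun hc x
    refine ⟨ModuleCat.of S Q, ⟨A', C', a, c, hA', hC', ?_, ?_, ?_⟩,
      ModuleCat.of S (L × M), ι, (LinearMap.range ι).mkQ, inferInstanceAs (Module.Free S (L × M)),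
      inferInstanceAs (Module.Finite S (L × M)), ?_, ?_, Submodule.mkQ_surjective _, fun φ => ?_⟩
    · rw [injective_iff_map_eq_zero]
      intro y hy
      obtain ⟨x, rfl⟩ := hq y
      rw [ha', hmk] at hy
      obtain ⟨b, hb⟩ := hy
      rw [hι, Prod.mk.injEq] at hb
      obtain ⟨w, rfl⟩ := (hex b).1 (hk (by rw [hb.2, map_zero]))
      rw [← hb.1, hf', hqj]
    · intro y
      obtain ⟨⟨x, z⟩, rfl⟩ := Submodule.mkQ_surjective _ y
      rw [hc']
      constructor
      · intro h
        obtain ⟨w, rfl⟩ := (hkr z).1 h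
        obtain ⟨b, rfl⟩ := hp w
        refine ⟨q (x - f b), ?_⟩
        rw [ha', ← sub_eq_zero, ← map_sub, hmk]
        exact ⟨-b, by simp [hι]⟩
      · rintro ⟨w, hw⟩
        obtain ⟨v, rfl⟩ := hq w
        rw [← hc' (x, z), ← hw, ha', hc', map_zero]
    · intro y
      obtain ⟨z, rfl⟩ := hr y
      exact ⟨(LinearMap.range ι).mkQ (0, z), by rw [hc']⟩
    · rw [injective_iff_map_eq_zero]
      intro b hb
      rw [hι, Prod.mk_eq_zero] at hb
      obtain ⟨w, rfl⟩ := (hex b).1 (hk (by rw [hb.2, map_zero]))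
      rw [hj (a₁ := w) (a₂ := 0) (by rw [← hf', hb.1, map_zero]), map_zero]
    · exact fun x => hmk x
    · obtain ⟨ψ, hψ⟩ := hd (φ ∘ₗ i)
      have hψ' (x : A) : ψ (j x) = φ (i x) := LinearMap.congr_fun hψ x
      obtain ⟨χ, hχ⟩ := LinearMap.exists_comp_eq_of_surjective p hp (φ - ψ ∘ₗ f) (by
        intro x hx
        obtain ⟨y, rfl⟩ := (hex x).1 hx
        simp [hf', hψ'])
      obtain ⟨ω, hω⟩ := hd' χ
      refine ⟨ψ.coprod ω, ?_⟩
      ext x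
      have h1 := LinearMap.congr_fun hχ x
      have h2 := LinearMap.congr_fun hω (p x)
      change χ (p x) = φ x - ψ (f x) at h1
      change ω (k (p x)) = χ (p x) at h2
      change ψ (f x) + ω (k (p x)) = φ x
      rw [h2, h1]
      abel

end TotallyReflexive

/-! ### Pushouts and quasi-isomorphisms from short exact sequences -/

section ShortExactSequences

/-- A pushout of a monomorphism is a monomorphism with the same cokernel. -/
theorem CategoryTheory.IsPushout.shortExact_of_mono {C : Type*} [Category* C] [Abelian C]
    {X Y Z P : C} {f : X ⟶ Y} {g : X ⟶ Z} {inl : Y ⟶ P} {inr : Z ⟶ P}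
    (h : IsPushout f g inl inr) [Mono g] :
    (ShortComplex.mk inl (h.desc 0 (cokernel.π g) (by simp)) (by simp)).ShortExact := by
  have : Mono inl := Abelian.mono_inl_of_isColimit _ _ h.isColimit
  let π := h.desc 0 (cokernel.π g) (by simp)
  have hr : inr ≫ π = cokernel.π g := by simp [π]
  have : Epi π := by
    have : Epi (inr ≫ π) := by rw [hr]; infer_instance
    exact epi_of_epi inr π
  refine { exact := ?_, mono_f := ‹_›, epi_g := ‹_› }
  refine ShortComplex.exact_of_g_is_cokernel _ (CokernelCofork.IsColimit.ofπ' _ _ fun {A} t ht => ?_)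
  have ht' : inl ≫ t = 0 := ht
  refine ⟨cokernel.desc g (inr ≫ t) (by rw [← h.w_assoc, ht', comp_zero]), ?_⟩
  apply h.hom_ext
  · simp [ht']
  · simp

theorem CategoryTheory.ShortComplex.ShortExact.quasiIso_f {C ι : Type*} [Category* C] [Abelian C]
    {c : ComplexShape ι} {S : ShortComplex (HomologicalComplex C c)} (hS : S.ShortExact)
    (h : S.X₃.Acyclic) : _root_.QuasiIso S.f := by
  rw [_root_.quasiIso_iff]
  intro i
  rw [quasiIsoAt_iff_isIso_homologyMap]
  have hz (i : ι) : IsZero (S.X₃.homology i) :=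
    (HomologicalComplex.exactAt_iff_isZero_homology _ _).1 (h i)
  have : Epi (HomologicalComplex.homologyMap S.f i) :=
    (hS.homology_exact₂ i).epi_f ((hz i).eq_of_tgt _ _)
  have : Mono (HomologicalComplex.homologyMap S.f i) := by
    -- Without a predecessor degree there is no connecting map, and injectivity comes from `S.f`
    -- itself.
    by_cases hi : ∃ j, c.Rel j i
    · obtain ⟨j, hj⟩ := hi
      exact (hS.homology_exact₁ j i hj).mono_g ((hz j).eq_of_src _ _)
    · have := hS.mono_f
      exact HomologicalComplex.mono_homologyMap_of_mono_of_not_rel S.f i (by simpa using hi)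
  exact isIso_of_mono_of_epi _

theorem CategoryTheory.ShortComplex.ShortExact.quasiIso_g {C ι : Type*} [Category* C] [Abelian C]
    {c : ComplexShape ι} {S : ShortComplex (HomologicalComplex C c)} (hS : S.ShortExact)
    (h : S.X₁.Acyclic) : _root_.QuasiIso S.g := by
  rw [_root_.quasiIso_iff]
  intro i
  rw [quasiIsoAt_iff_isIso_homologyMap]
  have hz (i : ι) : IsZero (S.X₁.homology i) :=
    (HomologicalComplex.exactAt_iff_isZero_homology _ _).1 (h i)
  have : Mono (HomologicalComplex.homologyMap S.g i) :=
    (hS.homology_exact₂ i).mono_g ((hz i).eq_of_src _ _)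
  have : Epi (HomologicalComplex.homologyMap S.g i) := by
    by_cases hi : ∃ j, c.Rel i j
    · obtain ⟨j, hj⟩ := hi
      exact (hS.homology_exact₃ i j hj).epi_f ((hz j).eq_of_tgt _ _)
    · have := hS.epi_g
      exact HomologicalComplex.epi_homologyMap_of_epi_of_not_rel S.g i (by simpa using hi)
  exact isIso_of_mono_of_epi _

end ShortExactSequences

/-! ### Contractible two-term complexes -/

section Disc

variable {C : Type*} [Category* C] [Abelian C]

theorem up_rel_succ (m : ℤ) : (ComplexShape.up ℤ).Rel m (m + 1) := rfl

theorem self_ne_succ (m : ℤ) : m ≠ m + 1 := by simp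

/-- The complex `X = X` concentrated in degrees `m` and `m + 1`. -/
noncomputable abbrev discComplex (X : C) (m : ℤ) : CochainComplex C ℤ :=
  HomologicalComplex.double (𝟙 X) (up_rel_succ m)

theorem isZero_discComplex_X (X : C) (m l : ℤ) (h₀ : l ≠ m) (h₁ : l ≠ m + 1) :
    IsZero ((discComplex X m).X l) :=
  HomologicalComplex.isZero_double_X _ _ _ h₀ h₁

theorem acyclic_discComplex (X : C) (m : ℤ) : (discComplex X m).Acyclic := by
  intro l
  rw [HomologicalComplex.exactAt_iff' _ (l - 1) l (l + 1) (by simp) (by simp)]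
  have hd : IsIso ((discComplex X m).d m (m + 1)) := by
    rw [HomologicalComplex.double_d _ _ (self_ne_succ m)]
    infer_instance
  by_cases h0 : l = m
  · subst h0
    rw [ShortComplex.exact_iff_mono _ ((isZero_discComplex_X _ _ _ (by lia)
      (by lia)).eq_of_src _ _)]
    exact inferInstanceAs (Mono ((discComplex X l).d l (l + 1)))
  by_cases h1 : l = m + 1
  · subst h1
    rw [ShortComplex.exact_iff_epi _ ((isZero_discComplex_X _ _ _ (by lia)
      (by lia)).eq_of_tgt _ _)]
    have : Epi ((discComplex X m).d (m + 1 - 1) (m + 1)) := by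
      rw [show m + 1 - 1 = m by ring]
      infer_instance
    exact this
  · exact ShortComplex.exact_of_isZero_X₂ _ (isZero_discComplex_X _ _ _ h0 h1)

/-- The morphism from a disc complex given by a morphism in its lower degree. -/
noncomputable def discComplexDesc {X : C} {m : ℤ} {K : CochainComplex C ℤ} (φ : X ⟶ K.X m) :
    discComplex X m ⟶ K :=
  HomologicalComplex.mkHomFromDouble _ (self_ne_succ m) φ (φ ≫ K.d m (m + 1)) (by simp) (by simp)

theorem discComplexDesc_f {X : C} {m : ℤ} {K : CochainComplex C ℤ} (φ : X ⟶ K.X m) :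
    (discComplexDesc φ).f m = (HomologicalComplex.doubleXIso₀ _ _).hom ≫ φ := by
  simp [discComplexDesc]

/-- The morphism of disc complexes induced by a morphism. -/
noncomputable def discComplexMap {X Y : C} (m : ℤ) (φ : X ⟶ Y) :
    discComplex X m ⟶ discComplex Y m :=
  HomologicalComplex.mkHomFromDouble _ (self_ne_succ m) (φ ≫ (HomologicalComplex.doubleXIso₀ _ _).inv)
    (φ ≫ (HomologicalComplex.doubleXIso₁ _ _ (self_ne_succ m)).inv)
    (by rw [HomologicalComplex.double_d _ _ (self_ne_succ m)]; simp)
    (fun k hk => (isZero_discComplex_X _ _ _ (by simp at hk; lia) (by simp at hk; lia)).eq_of_tgt _ _)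

theorem discComplexMap_f₁ {X Y : C} (m : ℤ) (φ : X ⟶ Y) :
    (discComplexMap m φ).f (m + 1) = (HomologicalComplex.doubleXIso₁ _ _ (self_ne_succ m)).hom ≫ φ ≫
      (HomologicalComplex.doubleXIso₁ _ _ (self_ne_succ m)).inv := by
  simp [discComplexMap]

theorem discComplexMap_f₀ {X Y : C} (m : ℤ) (φ : X ⟶ Y) :
    (discComplexMap m φ).f m = (HomologicalComplex.doubleXIso₀ _ _).hom ≫ φ ≫
      (HomologicalComplex.doubleXIso₀ _ _).inv := by
  simp [discComplexMap]

instance mono_discComplexMap {X Y : C} (m : ℤ) (φ : X ⟶ Y) [Mono φ] :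
    Mono (discComplexMap m φ) := by
  refine HomologicalComplex.mono_of_mono_f _ fun l => ?_
  by_cases h0 : l = m
  · subst h0
    rw [discComplexMap_f₀]
    infer_instance
  by_cases h1 : l = m + 1
  · subst h1
    rw [discComplexMap_f₁]
    infer_instance
  · exact (isZero_discComplex_X _ _ _ h0 h1).mono _

end Disc

/-! ### Subcomplexes and quotient complexes of modules -/

section Subcomplex

variable {S : Type u} [CommRing S] (K : CochainComplex (ModuleCat.{u} S) ℤ)
  (W : ∀ l, Submodule S (K.X l)) (hW : ∀ i j, W i ≤ (W j).comap (K.d i j).hom)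

/-- The subcomplex given by a family of submodules that is stable under the differential. -/
def moduleSubcomplex : CochainComplex (ModuleCat.{u} S) ℤ where
  X l := ModuleCat.of S (W l)
  d i j := ModuleCat.ofHom ((K.d i j).hom.restrict (hW i j))
  shape i j h := by
    ext x
    change (K.d i j).hom x.1 = 0
    rw [K.shape i j h]
    rfl
  d_comp_d' i j k _ _ := by
    ext x
    change (K.d i j ≫ K.d j k).hom x.1 = 0
    rw [K.d_comp_d]
    rfl

/-- The quotient of a complex by a family of submodules that is stable under the differential. -/
def moduleQuotientComplex : CochainComplex (ModuleCat.{u} S) ℤ where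
  X l := ModuleCat.of S (K.X l ⧸ W l)
  d i j := ModuleCat.ofHom ((W i).mapQ (W j) (K.d i j).hom (hW i j))
  shape i j h := by
    ext x
    change (W j).mkQ ((K.d i j).hom x) = 0
    rw [K.shape i j h]
    exact map_zero _
  d_comp_d' i j k _ _ := by
    ext x
    change (W k).mkQ ((K.d i j ≫ K.d j k).hom x) = 0
    rw [K.d_comp_d]
    exact map_zero _

/-- The short complex of a subcomplex and the corresponding quotient. -/
def moduleSubcomplexSequence : ShortComplex (CochainComplex (ModuleCat.{u} S) ℤ) where
  X₁ := moduleSubcomplex K W hW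
  X₂ := K
  X₃ := moduleQuotientComplex K W hW
  f := { f := fun l => ModuleCat.ofHom (W l).subtype }
  g := { f := fun l => ModuleCat.ofHom (W l).mkQ }
  zero := by
    ext l x
    exact (Submodule.Quotient.mk_eq_zero _).2 x.2

theorem shortExact_moduleSubcomplexSequence : (moduleSubcomplexSequence K W hW).ShortExact := by
  refine HomologicalComplex.shortExact_of_degreewise_shortExact _ fun l => ?_
  refine ModuleCat.shortComplex_shortExact _ ?_ ?_ ?_
  · rw [LinearMap.exact_iff]
    exact (Submodule.ker_mkQ _).trans (Submodule.range_subtype _).symm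
  · exact Subtype.val_injective
  · exact Submodule.mkQ_surjective _

theorem acyclic_moduleSubcomplex
    (h : ∀ l, ∀ x ∈ W l, (K.d l (l + 1)).hom x = 0 → ∃ y ∈ W (l - 1), (K.d (l - 1) l).hom y = x) :
    (moduleSubcomplex K W hW).Acyclic := by
  intro l
  rw [HomologicalComplex.exactAt_iff' _ (l - 1) l (l + 1) (by simp) (by simp),
    ShortComplex.moduleCat_exact_iff]
  rintro ⟨x, hx⟩ h0
  obtain ⟨y, hy, hyx⟩ := h l x hx (congrArg Subtype.val h0)
  exact ⟨⟨y, hy⟩, Subtype.ext hyx⟩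

end Subcomplex

/-! ### Replacing totally reflexive terms by free ones -/

section Replacement

variable {S : Type u} [CommRing S]

theorem isTotallyReflexive_of_isZero {G : ModuleCat.{u} S} (h : IsZero G) :
    IsTotallyReflexive G := by
  have := ModuleCat.subsingleton_of_isZero h
  exact isTotallyReflexive_of_projective

theorem isTotallyReflexive_of_shortExact (T : ShortComplex (ModuleCat.{u} S)) (hT : T.ShortExact)
    (h1 : IsTotallyReflexive T.X₁) (h3 : IsTotallyReflexive T.X₃) : IsTotallyReflexive T.X₂ :=
  isTotallyReflexive_of_extension h1 h3 T.f.hom T.g.hom hT.moduleCat_injective_f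
    ((ShortComplex.ShortExact.moduleCat_exact_iff_function_exact T).1 hT.exact)
    hT.moduleCat_surjective_g

variable [HasDerivedCategory.{w} (ModuleCat.{u} S)]

/-- A complex of totally reflexive modules can be replaced, up to quasi-isomorphism, by one with a
free module in a given degree, changing only the next degree besides. -/
theorem exists_complex_free_at (Y : CochainComplex (ModuleCat.{u} S) ℤ)
    (hY : ∀ l, IsTotallyReflexive (Y.X l)) (m : ℤ) :
    ∃ Y' : CochainComplex (ModuleCat.{u} S) ℤ, (∀ l, IsTotallyReflexive (Y'.X l)) ∧
      Module.Free S (Y'.X m) ∧ (∀ l, l ≠ m → l ≠ m + 1 → Nonempty (Y'.X l ≅ Y.X l)) ∧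
      Nonempty (DerivedCategory.Q.obj Y ≅ DerivedCategory.Q.obj Y') := by
  obtain ⟨G, hG, L, i, p, hfree, hfin, hi, hip, hp, -⟩ := (hY m).exists_right
  let ι : Y.X m ⟶ L := ModuleCat.ofHom i
  have : Mono ι := (ModuleCat.mono_iff_injective _).2 hi
  -- `f` is an isomorphism in degree `m`, so the pushout has `L` there; in degree `m + 1` it is an
  -- extension of `G` by `Y.X (m + 1)`; elsewhere nothing changes.
  let f : discComplex (Y.X m) m ⟶ Y := discComplexDesc (𝟙 _)
  let g := discComplexMap m ι
  have sq : IsPushout f g (pushout.inl f g) (pushout.inr f g) := IsPushout.of_hasPushout f g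
  have sql (l : ℤ) : IsPushout (f.f l) (g.f l) ((pushout.inl f g).f l) ((pushout.inr f g).f l) :=
    sq.map (HomologicalComplex.eval _ _ l)
  have e0 : (pushout f g).X m ≅ L := by
    have : IsIso (f.f m) := by
      rw [discComplexDesc_f]
      infer_instance
    have := (sql m).isIso_inr_of_isIso
    exact (asIso ((pushout.inr f g).f m)).symm ≪≫ HomologicalComplex.doubleXIso₀ _ _
  have e2 (l : ℤ) (h0 : l ≠ m) (h1 : l ≠ m + 1) : (pushout f g).X l ≅ Y.X l := by
    have : IsIso (g.f l) := IsZero.isIso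
      (isZero_discComplex_X _ _ _ h0 h1) (isZero_discComplex_X _ _ _ h0 h1) _
    have := (sql l).isIso_inl_of_isIso
    exact (asIso ((pushout.inl f g).f l)).symm
  have h1 : IsTotallyReflexive ((pushout f g).X (m + 1)) := by
    refine isTotallyReflexive_of_shortExact _ (sql (m + 1)).shortExact_of_mono (hY _) ?_
    refine hG.of_iso (cokernel.mapIso _ ι (HomologicalComplex.doubleXIso₁ _ _ (self_ne_succ m))
      (HomologicalComplex.doubleXIso₁ _ _ (self_ne_succ m)) ?_ ≪≫
      ModuleCat.cokernelIsoRangeQuotient ι ≪≫ LinearEquiv.toModuleIso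
        (Submodule.quotEquivOfEq _ _ (LinearMap.exact_iff.1 hip).symm ≪≫ₗ
          p.quotKerEquivOfSurjective hp))
    rw [discComplexMap_f₁]
    simp
  refine ⟨pushout f g, fun l => ?_, ?_, fun l h0 h1 => ⟨e2 l h0 h1⟩, ?_⟩
  · by_cases h0 : l = m
    · subst h0
      exact isTotallyReflexive_of_projective.of_iso e0
    by_cases h1' : l = m + 1
    · subst h1'
      exact h1
    · exact (hY l).of_iso (e2 l h0 h1')
  · exact Module.Free.of_equiv e0.symm.toLinearEquiv
  -- Both discs are acyclic, hence so is the cokernel of `g`, which is also the cokernel of `Y →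
  -- pushout f g`.
  · have hac : (cokernel g).Acyclic := by
      have hg : (ShortComplex.mk g (cokernel.π g) (by simp)).ShortExact :=
        { exact := ShortComplex.exact_cokernel g
          mono_f := mono_discComplexMap m ι
          epi_g := inferInstanceAs (Epi (cokernel.π g)) }
      exact hg.acyclic_X₃ ⟨fun l => (quasiIsoAt_iff_exactAt g l (acyclic_discComplex _ _ l)).2
        (acyclic_discComplex _ _ l)⟩
    have := sq.shortExact_of_mono.quasiIso_f hac
    have : QuasiIso (pushout.inl f g) := this
    exact ⟨asIso (DerivedCategory.Q.map (pushout.inl f g))⟩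

theorem exists_complex_free_le (Y : CochainComplex (ModuleCat.{u} S) ℤ)
    (hY : ∀ l, IsTotallyReflexive (Y.X l)) (a b : ℤ) [Y.IsStrictlyGE a] [Y.IsStrictlyLE b] (k : ℤ)
    (hk : a ≤ k + 1) :
    ∃ (Y' : CochainComplex (ModuleCat.{u} S) ℤ) (b' : ℤ), (∀ l, IsTotallyReflexive (Y'.X l)) ∧
      (∀ l ≤ k, Module.Free S (Y'.X l)) ∧ Y'.IsStrictlyGE a ∧ Y'.IsStrictlyLE b' ∧
      Nonempty (DerivedCategory.Q.obj Y ≅ DerivedCategory.Q.obj Y') := by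
  -- Induction upwards from degree `a - 1`, up to which `Y` vanishes. Treating degree `k` disturbs
  -- only `k` and `k + 1`, so the free terms below `k` survive.
  obtain ⟨n, hn⟩ : ∃ n : ℕ, k = a - 1 + n := ⟨(k + 1 - a).toNat, by lia⟩
  clear hk
  induction n generalizing k with
  | zero =>
    refine ⟨Y, b, hY, fun l hl => ?_, ‹_›, ‹_›, ⟨Iso.refl _⟩⟩
    have := ModuleCat.subsingleton_of_isZero (Y.isZero_of_isStrictlyGE a l)
    infer_instance
  | succ n ih =>
    obtain ⟨Z, c, hZ, hfree, hge, hle, ⟨e⟩⟩ := ih (k - 1) (by push_cast at hn; lia)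
    obtain ⟨Z', hZ', hm, hiso, ⟨e'⟩⟩ := exists_complex_free_at Z hZ k
    refine ⟨Z', max c (k + 1), hZ', fun l hl => ?_, ?_, ?_, ⟨e ≪≫ e'⟩⟩
    · rcases hl.lt_or_eq with hl | rfl
      · obtain ⟨e⟩ := hiso l hl.ne (by lia)
        have := hfree l (by lia)
        exact Module.Free.of_equiv e.symm.toLinearEquiv
      · exact hm
    · rw [CochainComplex.isStrictlyGE_iff]
      intro l hl
      obtain ⟨e⟩ := hiso l (by lia) (by lia)
      exact (Z.isZero_of_isStrictlyGE a l).of_iso e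
    · rw [CochainComplex.isStrictlyLE_iff]
      intro l hl
      obtain ⟨e⟩ := hiso l (by lia) (by lia)
      exact (Z.isZero_of_isStrictlyLE c l).of_iso e

end Replacement

/-! ### Extended integers -/

section ExtendedIntegers

theorem Int.toExt_le_toExt {m n : ℤ} : m.toExt ≤ n.toExt ↔ m ≤ n := by
  simp [Int.toExt]

theorem Int.toExt_add_one (n : ℤ) : n.toExt + 1 = (n + 1).toExt := rfl

/-- The integer lower bound excludes `-∞` and finiteness excludes the empty set, so the infimum is
attained. -/
theorem exists_isLeast_of_toExt_le_sInf {s : Set ℤ} {n : ℤ} (h : n.toExt ≤ sInf (Int.toExt '' s))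
    (h' : sInf (Int.toExt '' s) < ⊤) : ∃ d, IsLeast s d ∧ sInf (Int.toExt '' s) = d.toExt := by
  have hne : s.Nonempty := by
    by_contra hs
    rw [Set.not_nonempty_iff_eq_empty] at hs
    simp [hs] at h'
  have hb (z : ℤ) (hz : z ∈ s) : n ≤ z :=
    Int.toExt_le_toExt.1 (h.trans (sInf_le ⟨z, hz, rfl⟩))
  obtain ⟨d, hd, hd'⟩ := Int.exists_least_of_bdd ⟨n, hb⟩ hne
  refine ⟨d, ⟨hd, hd'⟩, le_antisymm (sInf_le ⟨d, hd, rfl⟩) (le_sInf ?_)⟩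
  rintro _ ⟨z, hz, rfl⟩
  exact Int.toExt_le_toExt.2 (hd' z hz)

end ExtendedIntegers

/-! ### Homotopies between K-projective complexes -/

section HomotopyRetract

/-- On K-projective sources, morphisms in the derived category are homotopy classes of chain maps,
so both directions of `e` lift. -/
theorem exists_homotopy_of_isKProjective {C : Type*} [Category* C] [Abelian C]
    [HasDerivedCategory C] (P K : CochainComplex C ℤ) [P.IsKProjective] [K.IsKProjective]
    (e : DerivedCategory.Q.obj P ≅ DerivedCategory.Q.obj K) :
    ∃ (α : P ⟶ K) (β : K ⟶ P), Nonempty (Homotopy (α ≫ β) (𝟙 P)) := by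
  let e' := (DerivedCategory.quotientCompQhIso C).app P ≪≫ e ≪≫
    ((DerivedCategory.quotientCompQhIso C).app K).symm
  obtain ⟨α', hα'⟩ := (CochainComplex.IsKProjective.Qh_map_bijective P
    ((HomotopyCategory.quotient _ _).obj K)).2 e'.hom
  obtain ⟨β', hβ'⟩ := (CochainComplex.IsKProjective.Qh_map_bijective K
    ((HomotopyCategory.quotient _ _).obj P)).2 e'.inv
  obtain ⟨α, rfl⟩ := (HomotopyCategory.quotient _ _).map_surjective α'
  obtain ⟨β, rfl⟩ := (HomotopyCategory.quotient _ _).map_surjective β'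
  refine ⟨α, β, ⟨HomotopyCategory.homotopyOfEq _ _ ?_⟩⟩
  apply (CochainComplex.IsKProjective.Qh_map_bijective P _).1
  rw [Functor.map_comp, Functor.map_comp, hα', hβ', e'.hom_inv_id, CategoryTheory.Functor.map_id,
    CategoryTheory.Functor.map_id]
  rfl

/-- In degree `a` the composite `α ≫ β` passes through `K.X a = 0`, and the homotopy into `P.X (a -
1) = 0` vanishes. What is left of the homotopy relation is `0 = d ≫ h + 𝟙`. -/
theorem exists_retraction_of_isKProjective {C : Type*} [Category* C] [Abelian C]
    [HasDerivedCategory C] (P K : CochainComplex C ℤ) [P.IsKProjective] [K.IsKProjective]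
    (e : DerivedCategory.Q.obj P ≅ DerivedCategory.Q.obj K) (a : ℤ) [P.IsStrictlyGE a]
    [K.IsStrictlyGE (a + 1)] : ∃ s : P.X (a + 1) ⟶ P.X a, P.d a (a + 1) ≫ s = 𝟙 _ := by
  obtain ⟨α, β, ⟨H⟩⟩ := exists_homotopy_of_isKProjective P K e
  have h := H.comm a
  rw [dNext_eq H.hom (up_rel_succ a), prevD_eq H.hom (show (ComplexShape.up ℤ).Rel (a - 1) a by simp),
    (P.isZero_of_isStrictlyGE a (a - 1)).eq_of_tgt (H.hom a (a - 1)) 0, zero_comp, add_zero,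
    HomologicalComplex.comp_f,
    (K.isZero_of_isStrictlyGE (a + 1) a).eq_of_tgt (α.f a) 0, zero_comp,
    HomologicalComplex.id_f] at h
  refine ⟨-H.hom (a + 1) a, ?_⟩
  rw [Preadditive.comp_neg, neg_eq_iff_add_eq_zero]
  exact h.symm

end HomotopyRetract

/-! ### Shortening a complex whose first differential splits -/

section Retraction

variable {S : Type u} [CommRing S] [HasDerivedCategory.{w} (ModuleCat.{u} S)]

theorem exists_complex_of_retraction (Y : CochainComplex (ModuleCat.{u} S) ℤ)
    (hY : ∀ l, IsTotallyReflexive (Y.X l)) (a b : ℤ) [Y.IsStrictlyGE a] [Y.IsStrictlyLE b]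
    (t : Y.X (a + 1) ⟶ Y.X a) (ht : Y.d a (a + 1) ≫ t = 𝟙 _)
    (h : Module.Projective S (Y.X (a + 1)) ∨ IsZero (Y.X a)) :
    ∃ Y' : CochainComplex (ModuleCat.{u} S) ℤ, (∀ l, IsTotallyReflexive (Y'.X l)) ∧
      Y'.IsStrictlyGE (a + 1) ∧ Y'.IsStrictlyLE b ∧
      Nonempty (DerivedCategory.Q.obj Y ≅ DerivedCategory.Q.obj Y') := by
  have ht' (x : Y.X a) : t.hom ((Y.d a (a + 1)).hom x) = x :=
    LinearMap.congr_fun (congrArg ModuleCat.Hom.hom ht) x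
  -- The subcomplex `Y.X a → d (Y.X a)` is acyclic because `t` makes the differential injective;
  -- dividing it out removes degree `a`.
  let W (l : ℤ) : Submodule S (Y.X l) := if l = a then ⊤ else LinearMap.range (Y.d a l).hom
  have hWa : W a = ⊤ := if_pos rfl
  have hWs (l : ℤ) (hl : l ≠ a) : W l = LinearMap.range (Y.d a l).hom := if_neg hl
  have hWb (l : ℤ) (hl : l ≠ a) (hl' : l ≠ a + 1) : W l = ⊥ := by
    rw [hWs l hl, Y.shape a l (by simpa using hl'.symm)]
    exact LinearMap.range_zero
  have hW (i j : ℤ) : W i ≤ (W j).comap (Y.d i j).hom := by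
    intro x hx
    rw [Submodule.mem_comap]
    by_cases hj : j = a
    · subst hj
      rw [hWa]
      trivial
    by_cases hi : i = a
    · subst hi
      rw [hWs j hj]
      exact ⟨x, rfl⟩
    · rw [hWs i hi] at hx
      obtain ⟨y, rfl⟩ := hx
      have : (Y.d a i ≫ Y.d i j).hom y = 0 := by
        rw [Y.d_comp_d]
        rfl
      change (Y.d a i ≫ Y.d i j).hom y ∈ W j
      rw [this]
      exact zero_mem _
  have hac : (moduleSubcomplex Y W hW).Acyclic := by
    refine acyclic_moduleSubcomplex Y W hW fun l x hx h0 => ?_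
    by_cases hl : l = a
    · subst hl
      refine ⟨0, zero_mem _, ?_⟩
      rw [map_zero, ← ht' x, h0, map_zero]
    by_cases hl' : l = a + 1
    · subst hl'
      rw [hWs _ hl] at hx
      obtain ⟨y, rfl⟩ := hx
      rw [show a + 1 - 1 = a by ring]
      exact ⟨y, by rw [hWa]; trivial, rfl⟩
    · rw [hWb l hl hl'] at hx
      exact ⟨0, zero_mem _, by rw [map_zero, (Submodule.mem_bot S).1 hx]⟩
  have hiso (l : ℤ) (hl : W l = ⊥) : IsTotallyReflexive (ModuleCat.of S (Y.X l ⧸ W l)) :=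
    (hY l).of_iso (Submodule.quotEquivOfEqBot _ hl).toModuleIso
  have hzero (l : ℤ) (hl : IsZero (Y.X l)) : IsZero (ModuleCat.of S (Y.X l ⧸ W l)) := by
    have := ModuleCat.subsingleton_of_isZero hl
    exact ModuleCat.isZero_of_subsingleton _
  have hzero' : IsZero (ModuleCat.of S (Y.X a ⧸ W a)) := by
    have : Subsingleton (Y.X a ⧸ W a) := Submodule.Quotient.subsingleton_iff.2 hWa
    exact ModuleCat.isZero_of_subsingleton _
  refine ⟨moduleQuotientComplex Y W hW, fun l => ?_, ?_, ?_, ?_⟩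
  · change IsTotallyReflexive (ModuleCat.of S (Y.X l ⧸ W l))
    by_cases hl : l = a
    · subst hl
      exact isTotallyReflexive_of_isZero hzero'
    by_cases hl' : l = a + 1
    · subst hl'
      rcases h with h | h
      · have := (hY (a + 1)).finite
        -- The endomorphism `1 - d t` kills the image of `d` and splits the projection, so the
        -- quotient is a summand of a projective module.
        have hp : W (a + 1) ≤ LinearMap.ker (LinearMap.id - (Y.d a (a + 1)).hom ∘ₗ t.hom) := by
          rw [hWs _ hl]
          rintro _ ⟨y, rfl⟩
          simp [ht']
        have : Module.Projective S (Y.X (a + 1) ⧸ W (a + 1)) := by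
          refine Module.Projective.of_split ((W (a + 1)).liftQ _ hp) (W (a + 1)).mkQ ?_
          apply Submodule.linearMap_qext
          ext x
          have : (W (a + 1)).mkQ ((Y.d a (a + 1)).hom (t.hom x)) = 0 := by
            rw [Submodule.mkQ_apply, Submodule.Quotient.mk_eq_zero, hWs _ hl]
            exact ⟨_, rfl⟩
          change (W (a + 1)).mkQ (x - (Y.d a (a + 1)).hom (t.hom x)) = (W (a + 1)).mkQ x
          rw [map_sub, this, sub_zero]
        have : Module.Projective S (ModuleCat.of S (Y.X (a + 1) ⧸ W (a + 1))) := this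
        have : Module.Finite S (ModuleCat.of S (Y.X (a + 1) ⧸ W (a + 1))) :=
          inferInstanceAs (Module.Finite S (Y.X (a + 1) ⧸ W (a + 1)))
        exact isTotallyReflexive_of_projective
      · refine hiso _ ?_
        rw [hWs _ hl, h.eq_of_src (Y.d a (a + 1)) 0]
        exact LinearMap.range_zero
    · exact hiso l (hWb l hl hl')
  · rw [CochainComplex.isStrictlyGE_iff]
    intro l hl
    by_cases hl' : l = a
    · subst hl'
      exact hzero'
    · exact hzero l (Y.isZero_of_isStrictlyGE a l)
  · rw [CochainComplex.isStrictlyLE_iff]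
    intro l hl
    exact hzero l (Y.isZero_of_isStrictlyLE b l)
  · let π : Y ⟶ moduleQuotientComplex Y W hW := (moduleSubcomplexSequence Y W hW).g
    have : QuasiIso π := (shortExact_moduleSubcomplexSequence Y W hW).quasiIso_g hac
    exact ⟨asIso (DerivedCategory.Q.map π)⟩

end Retraction

/-! ### Brutal truncations -/

section Truncation

variable {S : Type u} [CommRing S]

/-- The part of a complex in degrees above `k`, as a family of submodules. -/
def submodulesAbove (Y : CochainComplex (ModuleCat.{u} S) ℤ) (k l : ℤ) : Submodule S (Y.X l) :=
  if l ≤ k then ⊥ else ⊤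

theorem submodulesAbove_le_comap (Y : CochainComplex (ModuleCat.{u} S) ℤ) (k i j : ℤ) :
    submodulesAbove Y k i ≤ (submodulesAbove Y k j).comap (Y.d i j).hom := by
  intro x hx
  rw [Submodule.mem_comap]
  unfold submodulesAbove at hx ⊢
  split_ifs with hj
  · split_ifs at hx with hi
    · rw [(Submodule.mem_bot S).1 hx, map_zero]
      exact zero_mem _
    · rw [Y.shape i j (by simp; lia)]
      rfl
  · trivial

/-- The subcomplex in degrees above `k`. -/
abbrev complexAbove (Y : CochainComplex (ModuleCat.{u} S) ℤ) (k : ℤ) :=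
  moduleSubcomplex Y (submodulesAbove Y k) (submodulesAbove_le_comap Y k)

/-- The quotient complex in degrees up to `k`. -/
abbrev complexUpTo (Y : CochainComplex (ModuleCat.{u} S) ℤ) (k : ℤ) :=
  moduleQuotientComplex Y (submodulesAbove Y k) (submodulesAbove_le_comap Y k)

theorem isZero_complexAbove_X (Y : CochainComplex (ModuleCat.{u} S) ℤ) {k l : ℤ} (h : l ≤ k) :
    IsZero ((complexAbove Y k).X l) := by
  have : submodulesAbove Y k l = ⊥ := if_pos h
  have : Subsingleton (submodulesAbove Y k l) := by rw [this]; infer_instance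
  exact ModuleCat.isZero_of_subsingleton (ModuleCat.of S (submodulesAbove Y k l))

theorem isZero_complexUpTo_X (Y : CochainComplex (ModuleCat.{u} S) ℤ) {k l : ℤ} (h : k < l) :
    IsZero ((complexUpTo Y k).X l) := by
  have : Subsingleton (Y.X l ⧸ submodulesAbove Y k l) :=
    Submodule.Quotient.subsingleton_iff.2 (if_neg (by lia))
  exact ModuleCat.isZero_of_subsingleton (ModuleCat.of S (Y.X l ⧸ submodulesAbove Y k l))

/-- Above `k`, the terms of `complexAbove Y k` are those of `Y`. -/
def complexAboveXIso (Y : CochainComplex (ModuleCat.{u} S) ℤ) {k l : ℤ} (h : k < l) :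
    (complexAbove Y k).X l ≅ Y.X l :=
  (LinearEquiv.ofTop (submodulesAbove Y k l) (if_neg (by lia))).toModuleIso

/-- The projection of a complex to its quotient in degrees up to `k`. -/
abbrev toComplexUpTo (Y : CochainComplex (ModuleCat.{u} S) ℤ) (k : ℤ) : Y ⟶ complexUpTo Y k :=
  (moduleSubcomplexSequence Y (submodulesAbove Y k) (submodulesAbove_le_comap Y k)).g

theorem isIso_toComplexUpTo_f (Y : CochainComplex (ModuleCat.{u} S) ℤ) {k l : ℤ} (h : l ≤ k) :
    IsIso ((toComplexUpTo Y k).f l) := by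
  have hb : submodulesAbove Y k l = ⊥ := if_pos h
  rw [ConcreteCategory.isIso_iff_bijective]
  refine ⟨?_, Submodule.mkQ_surjective _⟩
  have : Function.Injective (submodulesAbove Y k l).mkQ := by
    rw [← LinearMap.ker_eq_bot, Submodule.ker_mkQ, hb]
  exact this

end Truncation

/-! ### Homology of complexes and the long exact sequence -/

section Homology

variable {S : Type u} [CommRing S] [HasDerivedCategory.{w} (ModuleCat.{u} S)]

theorem subsingleton_homologyMod_of_isZero {X : DerivedCategory (ModuleCat.{u} S)}
    {K : CochainComplex (ModuleCat.{u} S) ℤ} (e : X ≅ DerivedCategory.Q.obj K) (l : ℤ)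
    (h : IsZero (K.X (-l))) : Subsingleton (homologyMod X l) := by
  refine ModuleCat.subsingleton_of_isZero (IsZero.of_iso (Y := K.homology (-l)) ?_
    ((DerivedCategory.homologyFunctor _ (-l)).mapIso e ≪≫
      (DerivedCategory.homologyFunctorFactors _ (-l)).app K))
  exact ShortComplex.isZero_homology_of_isZero_X₂ _ h

theorem finite_homologyMod [IsNoetherianRing S] {X : DerivedCategory (ModuleCat.{u} S)}
    {K : CochainComplex (ModuleCat.{u} S) ℤ} (e : X ≅ DerivedCategory.Q.obj K) (l : ℤ)
    (h : Module.Finite S (K.X (-l))) : Module.Finite S (homologyMod X l) := by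
  have h1 : Module.Finite S (K.cycles (-l)) := Module.Finite.of_injective (K.iCycles (-l)).hom
    ((ModuleCat.mono_iff_injective _).1 inferInstance)
  have h2 : Module.Finite S (K.homology (-l)) := Module.Finite.of_surjective (K.homologyπ (-l)).hom
    ((ModuleCat.epi_iff_surjective _).1 inferInstance)
  have h3 : Module.Finite S
      ((HomologicalComplex.homologyFunctor (ModuleCat.{u} S) _ (-l)).obj K) := h2
  exact Module.Finite.equiv ((DerivedCategory.homologyFunctor _ (-l)).mapIso e ≪≫
      (DerivedCategory.homologyFunctorFactors _ (-l)).app K).symm.toLinearEquiv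

theorem isHomologicallyFinite_of_iso [IsNoetherianRing S] {X : DerivedCategory (ModuleCat.{u} S)}
    {K : CochainComplex (ModuleCat.{u} S) ℤ} (e : X ≅ DerivedCategory.Q.obj K)
    (h : ∀ l, Module.Finite S (K.X l)) (a b : ℤ) [K.IsStrictlyGE a] [K.IsStrictlyLE b] :
    IsHomologicallyFinite X := by
  refine ⟨fun l => finite_homologyMod e l (h _), (Set.finite_Icc (-b) (-a)).subset fun l hl => ?_⟩
  have hl : Nontrivial (homologyMod X l) := hl
  by_contra hl'
  rw [Set.mem_Icc, not_and_or] at hl'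
  refine not_subsingleton_iff_nontrivial.2 hl (subsingleton_homologyMod_of_isZero e l ?_)
  rcases hl' with h | h
  · exact K.isZero_of_isStrictlyLE b (-l)
  · exact K.isZero_of_isStrictlyGE a (-l)

variable {N P H : DerivedCategory (ModuleCat.{u} S)} {f : N ⟶ P} {g : P ⟶ H}
  {h : H ⟶ (shiftFunctor _ (1 : ℤ)).obj N}
  (hT : Triangle.mk f g h ∈ distTriang (DerivedCategory (ModuleCat.{u} S)))

include hT

theorem exact_homologyModMap (l : ℤ) :
    Function.Exact (homologyModMap f l) (homologyModMap g l) :=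
  (ShortComplex.ShortExact.moduleCat_exact_iff_function_exact _).1
    (DerivedCategory.HomologySequence.exact₂ _ hT (-l))

theorem exact_homologyModMap_connecting (l : ℤ) :
    Function.Exact (homologyModMap g l) (homologyModConnecting (Triangle.mk f g h) l) :=
  (ShortComplex.ShortExact.moduleCat_exact_iff_function_exact _).1
    (DerivedCategory.HomologySequence.exact₃ _ hT (-l) (-(l - 1)) (by lia))

theorem exact_connecting_homologyModMap (l : ℤ) :
    Function.Exact (homologyModConnecting (Triangle.mk f g h) l) (homologyModMap f (l - 1)) :=
  (ShortComplex.ShortExact.moduleCat_exact_iff_function_exact _).1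
    (DerivedCategory.HomologySequence.exact₁ _ hT (-l) (-(l - 1)) (by lia))

/-- Above `n` the map `H_l(N) → H_l(P)` is onto, as `H_l(H) = 0`; below `n` the connecting map
`H_l(H) → H_{l-1}(N)` is injective, as `H_l(P) = 0`. The ends of the five-term sequence are cut off
by `H_{n+1}(H) = 0` and `H_{n-1}(P) = 0`. -/
theorem homology_bounds_of_distTriang (n : ℤ)
    (hP : ∀ l < n, Subsingleton (homologyMod P l)) (hH : ∀ l > n, Subsingleton (homologyMod H l)) :
    (n.toExt ≤ homologyInf P ∧ homologySup H ≤ n.toExt) ∧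
      (homologySup P ≤ max n.toExt (homologySup N) ∧
        min n.toExt (homologyInf N + 1) ≤ homologyInf H) ∧
      (Function.Injective (homologyModMap f n) ∧
        Function.Exact (homologyModMap f n) (homologyModMap g n) ∧
        Function.Exact (homologyModMap g n) (homologyModConnecting (Triangle.mk f g h) n) ∧
        Function.Surjective (homologyModConnecting (Triangle.mk f g h) n)) := by
  have hsurj (l : ℤ) (hl : Subsingleton (homologyMod H l)) :
      Function.Surjective (homologyModMap f l) := fun y =>
    (exact_homologyModMap hT l y).1 (Subsingleton.elim _ _)
  have hinj (l : ℤ) (hl : Subsingleton (homologyMod P l)) :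
      Function.Injective (homologyModConnecting (Triangle.mk f g h) l) := by
    rw [injective_iff_map_eq_zero]
    intro x hx
    obtain ⟨y, rfl⟩ := (exact_homologyModMap_connecting hT l x).1 hx
    rw [Subsingleton.elim y 0]
    exact map_zero _
  refine ⟨⟨le_sInf ?_, sSup_le ?_⟩, ⟨sSup_le ?_, le_sInf ?_⟩, ?_, exact_homologyModMap hT n,
    exact_homologyModMap_connecting hT n, ?_⟩
  · rintro _ ⟨l, hl, rfl⟩
    rw [Int.toExt_le_toExt]
    by_contra! hln
    exact not_subsingleton_iff_nontrivial.2 hl (hP l hln)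
  · rintro _ ⟨l, hl, rfl⟩
    rw [Int.toExt_le_toExt]
    by_contra! hln
    exact not_subsingleton_iff_nontrivial.2 hl (hH l hln)
  · rintro _ ⟨l, hl, rfl⟩
    have hl : Nontrivial (homologyMod P l) := hl
    rcases le_or_gt l n with hln | hln
    · exact le_max_of_le_left (Int.toExt_le_toExt.2 hln)
    · exact le_max_of_le_right (le_sSup ⟨l, (hsurj l (hH l hln)).nontrivial, rfl⟩)
  · rintro _ ⟨l, hl, rfl⟩
    have hl : Nontrivial (homologyMod H l) := hl
    rcases le_or_gt n l with hln | hln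
    · exact min_le_of_left_le (Int.toExt_le_toExt.2 hln)
    · refine min_le_of_right_le ?_
      have : homologyInf N ≤ (l - 1).toExt :=
        sInf_le ⟨l - 1, @Function.Injective.nontrivial _ _ hl _ (hinj l (hP l hln)), rfl⟩
      calc homologyInf N + 1 ≤ (l - 1).toExt + 1 := by gcongr
        _ = l.toExt := by rw [Int.toExt_add_one, sub_add_cancel]
  · rw [injective_iff_map_eq_zero]
    -- A free variable `m` stands for `n + 1`, so that `m - 1` can be substituted for `n` in the
    -- types.
    have key (m : ℤ) (hm : m - 1 = n) (x : homologyMod N n) (hx : homologyModMap f n x = 0) :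
        x = 0 := by
      subst hm
      obtain ⟨y, rfl⟩ := (exact_connecting_homologyModMap hT m x).1 hx
      rw [(hH m (by lia)).elim y 0]
      exact map_zero _
    exact key (n + 1) (by ring)
  · intro y
    have := hP (n - 1) (by lia)
    exact (exact_connecting_homologyModMap hT n y).1 (Subsingleton.elim _ _)

end Homology

/-! ### The triangle and the main theorem -/

theorem distTriang_of_iso_obj₁ {C : Type*} [Category* C] [Preadditive C] [HasZeroObject C]
    [HasShift C ℤ] [∀ n : ℤ, (shiftFunctor C n).Additive] [Pretriangulated C] {X X' Y Z : C}
    (e : X' ≅ X) {f : X ⟶ Y} {g : Y ⟶ Z} {h : Z ⟶ (shiftFunctor C (1 : ℤ)).obj X}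
    (hT : Triangle.mk f g h ∈ distTriang C) :
    Triangle.mk (e.hom ≫ f) g (h ≫ (shiftFunctor C (1 : ℤ)).map e.inv) ∈ distTriang C := by
  refine isomorphic_distinguished _ hT _
    (Triangle.isoMk _ _ e (Iso.refl _) (Iso.refl _) ?_ ?_ ?_)
  · exact Category.comp_id _
  · exact (Category.comp_id _).trans (Category.id_comp _).symm
  · change (h ≫ (shiftFunctor C (1 : ℤ)).map e.inv) ≫ (shiftFunctor C (1 : ℤ)).map e.hom = 𝟙 Z ≫ h
    rw [Category.assoc, ← CategoryTheory.Functor.map_comp, e.inv_hom_id,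
      CategoryTheory.Functor.map_id, Category.comp_id, Category.id_comp]

theorem mainTheorem5 {S : Type u} [CommRing S] [IsNoetherianRing S]
    [HasDerivedCategory.{w} (ModuleCat.{u} S)]
    (N : DerivedCategory (ModuleCat.{u} S)) (hN : IsHomologicallyFinite N)
    (hG : gDim N < ⊤) (n : ℤ) (hn : n.toExt ≤ gDim N) :
    ∃ (P H : DerivedCategory (ModuleCat.{u} S))
      (f : N ⟶ P) (g : P ⟶ H) (h : H ⟶ (shiftFunctor _ (1 : ℤ)).obj N),
      Triangle.mk f g h ∈ distTriang (DerivedCategory (ModuleCat.{u} S)) ∧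
      IsHomologicallyFinite P ∧ IsHomologicallyFinite H ∧
      (projDim P = gDim N ∧ gDim H ≤ n.toExt) ∧
      (n.toExt ≤ homologyInf P ∧ homologySup H ≤ n.toExt) ∧
      (homologySup P ≤ max n.toExt (homologySup N) ∧
        min n.toExt (homologyInf N + 1) ≤ homologyInf H) ∧
      (Function.Injective (homologyModMap f n) ∧
        Function.Exact (homologyModMap f n) (homologyModMap g n) ∧
        Function.Exact (homologyModMap g n) (homologyModConnecting (Triangle.mk f g h) n) ∧
        Function.Surjective (homologyModConnecting (Triangle.mk f g h) n)) := by
  obtain ⟨d, ⟨⟨i, K, hge, hle, hK, ⟨e⟩⟩, hmin⟩, hd⟩ := exists_isLeast_of_toExt_le_sInf hn hG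
  have hnd : n ≤ d := by
    rw [gDim, hd] at hn
    exact Int.toExt_le_toExt.1 hn
  -- Free in degrees `≤ -n`, that is, in homological degrees `≥ n`, with nothing new above
  -- homological degree `d`.
  obtain ⟨Y, b, hY, hfree, hYge, hYle, ⟨e'⟩⟩ :=
    exists_complex_free_le K hK (-d) (-i) (-n) (by lia)
  let T := moduleSubcomplexSequence Y (submodulesAbove Y (-n)) (submodulesAbove_le_comap Y (-n))
  have hT : T.ShortExact := shortExact_moduleSubcomplexSequence _ _ _
  let eN := e ≪≫ e'
  let P := complexUpTo Y (-n)
  let W := complexAbove Y (-n)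
  have hPiso (l : ℤ) (hl : l ≤ -n) : Nonempty (Y.X l ≅ P.X l) :=
    have := isIso_toComplexUpTo_f Y hl
    ⟨asIso ((toComplexUpTo Y (-n)).f l)⟩
  have hPge : P.IsStrictlyGE (-d) := by
    rw [CochainComplex.isStrictlyGE_iff]
    intro l hl
    obtain ⟨e⟩ := hPiso l (by lia)
    exact (Y.isZero_of_isStrictlyGE (-d) l).of_iso e.symm
  have hPle : P.IsStrictlyLE (-n) := by
    rw [CochainComplex.isStrictlyLE_iff]
    exact fun l hl => isZero_complexUpTo_X Y hl
  have hPfree (l : ℤ) : Module.Free S (P.X l) ∧ Module.Finite S (P.X l) := by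
    rcases le_or_gt l (-n) with hl | hl
    · obtain ⟨e⟩ := hPiso l hl
      have := hfree l hl
      have := (hY l).finite
      exact ⟨Module.Free.of_equiv e.toLinearEquiv, Module.Finite.equiv e.toLinearEquiv⟩
    · have := ModuleCat.subsingleton_of_isZero (isZero_complexUpTo_X Y hl)
      exact ⟨inferInstance, inferInstance⟩
  have hPproj (l : ℤ) : Module.Projective S (P.X l) :=
    have := (hPfree l).1
    inferInstance
  have hPK : P.IsKProjective := by
    have (l : ℤ) : Projective (P.X l) := (IsProjective.iff_projective _).1 (hPproj l)
    exact CochainComplex.isKProjective_of_projective P (-n)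
  have hWX (l : ℤ) : IsTotallyReflexive (W.X l) := by
    rcases le_or_gt l (-n) with hl | hl
    · exact isTotallyReflexive_of_isZero (isZero_complexAbove_X Y hl)
    · exact (hY l).of_iso (complexAboveXIso Y hl)
  have hWge : W.IsStrictlyGE (-n + 1) := by
    rw [CochainComplex.isStrictlyGE_iff]
    exact fun l hl => isZero_complexAbove_X Y (by lia)
  -- The maximum keeps the degrees in question above `-n`, where `W` agrees with `Y`.
  have hWle : W.IsStrictlyLE (max b (-n)) := by
    rw [CochainComplex.isStrictlyLE_iff]
    intro l hl
    exact (Y.isZero_of_isStrictlyLE b l).of_iso (complexAboveXIso Y (by lia))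
  let W' := (shiftFunctor (CochainComplex (ModuleCat.{u} S) ℤ) (1 : ℤ)).obj W
  have hW'ge : W'.IsStrictlyGE (-n) := W.isStrictlyGE_shift (-n + 1) 1 (-n) (by lia)
  have hW'le : W'.IsStrictlyLE (-(1 - max b (-n))) :=
    W.isStrictlyLE_shift (max b (-n)) 1 _ (by lia)
  let eH : (shiftFunctor (DerivedCategory (ModuleCat.{u} S)) (1 : ℤ)).obj (DerivedCategory.Q.obj W) ≅
      DerivedCategory.Q.obj W' := ((DerivedCategory.Q.commShiftIso (1 : ℤ)).app W).symm
  have hdist : Triangle.mk (DerivedCategory.Q.map T.g) (DerivedCategory.triangleOfSESδ hT)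
      (-(shiftFunctor _ (1 : ℤ)).map (DerivedCategory.Q.map T.f)) ∈ distTriang _ := rot_of_distTriang _ (DerivedCategory.triangleOfSES_distinguished hT)
  have hdist' := distTriang_of_iso_obj₁ eN hdist
  refine ⟨DerivedCategory.Q.obj P, _, _, _, _, hdist',
    isHomologicallyFinite_of_iso (Iso.refl _) (fun l => (hPfree l).2) (-d) (-n),
    isHomologicallyFinite_of_iso eH (fun l => (hWX (l + 1)).finite) (-n) (-(1 - max b (-n))),
    ⟨?_, sInf_le ⟨n, ⟨_, W', hW'ge, hW'le, fun l => hWX (l + 1), ⟨eH⟩⟩, rfl⟩⟩, ?_⟩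
  · rw [gDim, hd]
    refine le_antisymm (sInf_le ⟨d, ⟨P, hPge, hPK, hPproj, ⟨Iso.refl _⟩⟩, rfl⟩) (le_sInf ?_)
    rintro _ ⟨c, ⟨Q, hQge, hQK, -, ⟨eQ⟩⟩, rfl⟩
    rw [Int.toExt_le_toExt]
    -- A semi-projective `Q` vanishing in homological degree `d` splits the differential leaving
    -- `P.X (-d)`; as `Y → P` is an isomorphism in that degree, the retraction pulls back to `Y`.
    by_contra! hc
    have : Q.IsStrictlyGE (-d + 1) := Q.isStrictlyGE_of_ge (-d + 1) (-c) (by lia)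
    obtain ⟨s, hs⟩ := exists_retraction_of_isKProjective P Q eQ (-d)
    have hπ : IsIso ((toComplexUpTo Y (-n)).f (-d)) := isIso_toComplexUpTo_f Y (by lia)
    have ht : Y.d (-d) (-d + 1) ≫ (toComplexUpTo Y (-n)).f (-d + 1) ≫ s ≫
        inv ((toComplexUpTo Y (-n)).f (-d)) = 𝟙 _ := by
      rw [← HomologicalComplex.Hom.comm_assoc, reassoc_of% hs, IsIso.hom_inv_id]
    -- If `n < d`, the next term of `Y` is still in the free range. If `n = d`, then `P` is zero in
    -- that degree, so the retraction is zero and forces `Y.X (-d) = 0`.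
    have hor : Module.Projective S (Y.X (-d + 1)) ∨ IsZero (Y.X (-d)) := by
      rcases hnd.lt_or_eq with h | rfl
      · have := hfree (-d + 1) (by lia)
        exact Or.inl inferInstance
      · right
        rw [IsZero.iff_id_eq_zero, ← ht,
          (isZero_complexUpTo_X Y (lt_add_one (-n))).eq_of_src
            (s ≫ inv ((toComplexUpTo Y (-n)).f (-n))) 0,
          comp_zero, comp_zero]
    obtain ⟨Y', hY', hY'ge, hY'le, ⟨e''⟩⟩ := exists_complex_of_retraction Y hY (-d) b _ ht hor
    -- The shortened complex represents `N` with top homological degree `d - 1`, contradicting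
    -- minimality.
    have := hmin (a := d - 1) ⟨-b, Y', by rwa [show -(d - 1) = -d + 1 by ring],
      by rwa [neg_neg], hY', ⟨eN ≪≫ e''⟩⟩
    lia
  · exact homology_bounds_of_distTriang hdist' n
      (fun l hl => subsingleton_homologyMod_of_isZero (Iso.refl _) l
        (isZero_complexUpTo_X Y (by lia)))
      (fun l hl => subsingleton_homologyMod_of_isZero eH l
        (W'.isZero_of_isStrictlyGE (-n) (-l)))
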